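/- Let $k\ge 1$, $n=2^k$, let $G=(g)_n$ be the cyclic group of order $n$ with generator $g$, let $\varepsilon\in\{1,-1\}$ and let $\mu\in\mathbb{C}$ satisfy $\mu^{n}=\varepsilon$. Put $A=\begin{pmatrix}1&0\\0&-1\end{pmatrix}$ and $C=\begin{pmatrix}0&1\\-1&0\end{pmatrix}$, and let $R=\mathcal{E}(\varepsilon,2^k)$ be the real subalgebra of $\mathbb{R}G\otimes_{\mathbb{R}} M_2(\mathbb{C})$ generated by $u=1\otimes C$ and $v=g\otimes\mu A$, with the $G$-grading $R_{g^j}=R\cap\left(\mathbb{R}g^j\otimes M_2(\mathbb{C})\right)$. Let $\mathbb{R}\langle X_G\rangle$ be the free unital associative $\mathbb{R}$-algebra on the variables $x_{i,t}$ ($i\in\mathbb{N}$, $t\in G$), graded by giving $x_{i,t}$ degree $t$. An admissible substitution replaces each $x_{i,t}$ by an element of $R_t$. Let $Id_G(R)$ (resp. $C_G(R)$) be the set of the $f\in\mathbb{R}\langle X_G\rangle$ all of whose values under admissible substitutions are $0$ (resp. lie in the center of $R$). A $T_G$-space is a linear subspace of $\mathbb{R}\langle X_G\rangle$ that is invariant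 under all degree-preserving algebra endomorphisms; a $T_G$-ideal is a two-sided ideal that is a $T_G$-space. A set $S$ is a basis of a $T_G$-ideal (resp. $T_G$-space) if the latter is the intersection of all $T_G$-ideals (resp. $T_G$-spaces) that contain $S$. Call $g^{j}$ even or odd according to the parity of $j$. Then: (i) a basis of the $T_G$-ideal $Id_G(R)$ consists of the polynomials $$x_{1,k_1}x_{2,k_2}-x_{2,k_2}x_{1,k_1},\qquad x_{1,h_1}x_{2,h_2}x_{3,h_3}-x_{3,h_3}x_{2,h_2}x_{1,h_1},$$ where $k_1,k_2$ run over the even and $h_1,h_2,h_3$ over the odd elements of $G$, independently; (ii) a basis of the $T_G$-space $C_G(R)$ consists of the constant polynomial $1$ and the polynomials $$x_{1,h_1}x_{2,h_2}+x_{2,h_2}x_{1,h_1},\qquad x_{1,g_1}[x_{2,k_1},x_{3,k_2}]x_{4,g_2},$$ $$x_{1,g_1}\left(x_{2,h_1}x_{3,h_2}x_{4,h_3}-x_{4,h_3}x_{3,h_2}x_{2,h_1}\right)x_{5,g_2},$$ where $k_1,k_2$ run over the even elements of $G$, $h_1,h_2,h_3$ over the odd elements and $g_1,g_2$ over all elements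 of $G$, independently. -/

import Mathlib

open scoped TensorProduct

noncomputable section

namespace GradedPI

section FreeGraded

variable (K : Type*) [Field K] (G : Type*) [AddCommMonoid G]

/-- The (unital) free `G`-graded algebra `K⟨X_G⟩` on the variables `x_{i,g}`, `i ∈ ℕ`, `g ∈ G`.
The grading group is written additively. -/
abbrev FreeGradedAlgebra : Type _ := FreeAlgebra K (ℕ × G)

variable {G}

/-- The variable `x_{i,g}`. -/
def x (i : ℕ) (g : G) : FreeGradedAlgebra K G := FreeAlgebra.ι K (i, g)

/-- The homogeneous component of degree `g` of `K⟨X_G⟩`: the span of the monomials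
`x_{i₁,g₁} ⋯ x_{iₘ,gₘ}` with `g₁ + ⋯ + gₘ = g`. -/
def freeComponent (g : G) : Submodule K (FreeGradedAlgebra K G) :=
  Submodule.span K
    {f | ∃ w : List (ℕ × G), (w.map Prod.snd).sum = g ∧ f = (w.map (FreeAlgebra.ι K)).prod}

variable {K}

/-- Graded (degree preserving) endomorphisms of `K⟨X_G⟩`. -/
def IsGradedEnd (φ : FreeGradedAlgebra K G →ₐ[K] FreeGradedAlgebra K G) : Prop :=
  ∀ g : G, ∀ f ∈ freeComponent K g, φ f ∈ freeComponent K g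

/-- `T_G`-spaces: subspaces of `K⟨X_G⟩` invariant under all graded endomorphisms. -/
def IsTSpace (V : Submodule K (FreeGradedAlgebra K G)) : Prop :=
  ∀ φ : FreeGradedAlgebra K G →ₐ[K] FreeGradedAlgebra K G, IsGradedEnd φ → ∀ f ∈ V, φ f ∈ V

/-- `T_G`-ideals: two-sided ideals of `K⟨X_G⟩` invariant under all graded endomorphisms. -/
def IsTIdeal (I : Submodule K (FreeGradedAlgebra K G)) : Prop :=
  IsTSpace I ∧ ∀ f ∈ I, ∀ p : FreeGradedAlgebra K G, p * f ∈ I ∧ f * p ∈ I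

/-- `S` is a basis of (generates) the `T_G`-ideal `I`: `I` is the intersection of all `T_G`-ideals
containing `S`. -/
def IsTIdealBasis (S I : Set (FreeGradedAlgebra K G)) : Prop :=
  I = ⋂ (J : Submodule K (FreeGradedAlgebra K G)) (_ : IsTIdeal J) (_ : S ⊆ (J : Set _)),
    (J : Set (FreeGradedAlgebra K G))

/-- `S` is a basis of (generates) the `T_G`-space `V`: `V` is the intersection of all `T_G`-spaces
containing `S`. -/
def IsTSpaceBasis (S V : Set (FreeGradedAlgebra K G)) : Prop :=
  V = ⋂ (W : Submodule K (FreeGradedAlgebra K G)) (_ : IsTSpace W) (_ : S ⊆ (W : Set _)),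
    (W : Set (FreeGradedAlgebra K G))

variable {A : Type*} [Ring A] [Algebra K A]

/-- Admissible substitutions: each `x_{i,g}` is replaced by an element of `A_g`. -/
def IsAdmissible (𝒜 : G → Submodule K A) (a : ℕ × G → A) : Prop :=
  ∀ p : ℕ × G, a p ∈ 𝒜 p.2

/-- `Id_G(A)`: the graded polynomial identities of `A = ⨁ A_g`. -/
def gradedIdentities (𝒜 : G → Submodule K A) : Set (FreeGradedAlgebra K G) :=
  {f | ∀ a : ℕ × G → A, IsAdmissible 𝒜 a → FreeAlgebra.lift K a f = 0}

/-- `C_G(A)`: the graded central polynomials of `A = ⨁ A_g`. -/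
def gradedCentralPolynomials (𝒜 : G → Submodule K A) : Set (FreeGradedAlgebra K G) :=
  {f | ∀ a : ℕ × G → A, IsAdmissible 𝒜 a → FreeAlgebra.lift K a f ∈ Subalgebra.center K A}

end FreeGraded

section AlgebraE

/-- The matrix `A = diag(1, -1)`. -/
def matA : Matrix (Fin 2) (Fin 2) ℂ := !![1, 0; 0, -1]

/-- The matrix `C`, with rows `(0, 1)` and `(-1, 0)`. -/
def matC : Matrix (Fin 2) (Fin 2) ℂ := !![0, 1; -1, 0]

/-- The real algebra `ℝ(g)ₙ ⊗ M₂(ℂ)`, where the cyclic group `(g)ₙ` is realised as `ZMod n`. -/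
abbrev Ambient (n : ℕ) : Type :=
  AddMonoidAlgebra ℝ (ZMod n) ⊗[ℝ] Matrix (Fin 2) (Fin 2) ℂ

/-- The tensor `gʲ ⊗ M`, linear in `M`. -/
def pureTensor (n : ℕ) (j : ZMod n) : Matrix (Fin 2) (Fin 2) ℂ →ₗ[ℝ] Ambient n :=
  TensorProduct.mk ℝ (AddMonoidAlgebra ℝ (ZMod n)) (Matrix (Fin 2) (Fin 2) ℂ)
    (AddMonoidAlgebra.single j 1)

/-- The real subalgebra of `ℝ(g)ₙ ⊗ M₂(ℂ)` generated by `u = 1 ⊗ C` and `v = g ⊗ μA`. For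
`μ ^ n = ε ∈ {1, -1}` this is `𝓔(ε, n)`, for which `u² = -1`, `uv = -vu` and, for even `n`,
`vⁿ = ε`. -/
def algE (n : ℕ) (μ : ℂ) : Subalgebra ℝ (Ambient n) :=
  Algebra.adjoin ℝ {pureTensor n 0 matC, pureTensor n 1 (μ • matA)}

/-- The homogeneous components of `𝓔(ε, n)`: its intersections with `(ℝ gʲ) ⊗ M₂(ℂ)`. -/
def algEComponent (n : ℕ) (μ : ℂ) (j : ZMod n) : Submodule ℝ (algE n μ) :=
  (LinearMap.range (pureTensor n j)).comap (algE n μ).val.toLinearMap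

end AlgebraE

section Polynomials

variable (n : ℕ)

/-- `x_{1,k₁} x_{2,k₂} - x_{2,k₂} x_{1,k₁}`, `k₁`, `k₂` even. -/
def evenCommutators : Set (FreeGradedAlgebra ℝ (ZMod n)) :=
  {f | ∃ k₁ k₂ : ZMod n, Even k₁ ∧ Even k₂ ∧
    f = x ℝ 1 k₁ * x ℝ 2 k₂ - x ℝ 2 k₂ * x ℝ 1 k₁}

/-- `x_{1,h₁} x_{2,h₂} x_{3,h₃} - x_{3,h₃} x_{2,h₂} x_{1,h₁}`, `h₁`, `h₂`, `h₃` odd. -/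
def oddTriples : Set (FreeGradedAlgebra ℝ (ZMod n)) :=
  {f | ∃ h₁ h₂ h₃ : ZMod n, Odd h₁ ∧ Odd h₂ ∧ Odd h₃ ∧
    f = x ℝ 1 h₁ * x ℝ 2 h₂ * x ℝ 3 h₃ - x ℝ 3 h₃ * x ℝ 2 h₂ * x ℝ 1 h₁}

/-- `x_{1,h₁} x_{2,h₂} + x_{2,h₂} x_{1,h₁}`, `h₁`, `h₂` odd. -/
def oddAnticommutators : Set (FreeGradedAlgebra ℝ (ZMod n)) :=
  {f | ∃ h₁ h₂ : ZMod n, Odd h₁ ∧ Odd h₂ ∧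
    f = x ℝ 1 h₁ * x ℝ 2 h₂ + x ℝ 2 h₂ * x ℝ 1 h₁}

/-- `x_{1,g₁} [x_{2,k₁}, x_{3,k₂}] x_{4,g₂}`, `k₁`, `k₂` even, `g₁`, `g₂` arbitrary. -/
def borderedEvenCommutators : Set (FreeGradedAlgebra ℝ (ZMod n)) :=
  {f | ∃ g₁ k₁ k₂ g₂ : ZMod n, Even k₁ ∧ Even k₂ ∧
    f = x ℝ 1 g₁ * (x ℝ 2 k₁ * x ℝ 3 k₂ - x ℝ 3 k₂ * x ℝ 2 k₁) * x ℝ 4 g₂}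

/-- `x_{1,g₁} (x_{2,h₁} x_{3,h₂} x_{4,h₃} - x_{4,h₃} x_{3,h₂} x_{2,h₁}) x_{5,g₂}`,
`h₁`, `h₂`, `h₃` odd, `g₁`, `g₂` arbitrary. -/
def borderedOddTriples : Set (FreeGradedAlgebra ℝ (ZMod n)) :=
  {f | ∃ g₁ h₁ h₂ h₃ g₂ : ZMod n, Odd h₁ ∧ Odd h₂ ∧ Odd h₃ ∧
    f = x ℝ 1 g₁ *
      (x ℝ 2 h₁ * x ℝ 3 h₂ * x ℝ 4 h₃ - x ℝ 4 h₃ * x ℝ 3 h₂ * x ℝ 2 h₁) * x ℝ 5 g₂}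

end Polynomials

end GradedPI

end

/-! For `0 ≤ j < n`, the component of degree `j` consists of the tensors `gʲ ⊗ z(μA)ʲ`, where `z`
runs over the copy `ℝ[C]` of `ℂ`, and `μA` acts on this copy by complex conjugation. In an
eigenbasis of `C`, a letter becomes `μʲ diag(z, z̄)`, followed by the exchange of the coordinates if
`j` is odd. In row 0 the value of a word is therefore a single monomial, in which a letter
contributes `z` or `z̄` according to the parity of the prefix before it (its state). The variables
and their conjugates are algebraically independent (`eq_zero_of_eval_conjPoint`), so for an identity
the coefficients of all words with the same multiset of letters with states, the data, add up to
zero (`dataMap_eq_zero_of_genericEval`). Words with equal data are linked by swaps of adjacent even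
factors and reversals of three adjacent odd ones (`IsSwapClosed.sub_mem_of_append`), which the
generators in (i) provide.

For (ii), commuting with an even variable kills the data of odd parity, and commuting with an odd
one makes the coefficients invariant under flipping all states. Modulo the bordered generators, `2f`
is then a combination of sums of a word and its flip. A nonempty word of even parity that admits a
flip splits into odd words as `ab`, with flip `ba`; hence these sums are anticommutators of odd
words or `1 + 1` (`IsSwapClosed.mem_of_dataMap_symm`). -/

open scoped TensorProduct

noncomputable section

namespace GradedPI

/-! ### Words, their data, and subspaces closed under swaps -/

section Words

variable (K : Type*) [Field K] {α : Type*}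

/-- The monomial of the free algebra that is spelled by a list of letters. -/
def word (w : List α) : FreeAlgebra K α := (w.map (FreeAlgebra.ι K)).prod

@[simp] lemma word_nil : word K ([] : List α) = 1 := rfl

@[simp] lemma word_cons (p : α) (w : List α) :
    word K (p :: w) = FreeAlgebra.ι K p * word K w := by
  simp [word]

@[simp] lemma word_append (u v : List α) : word K (u ++ v) = word K u * word K v := by
  simp [word]

lemma basisFreeMonoid_apply (w : FreeMonoid α) :
    FreeAlgebra.basisFreeMonoid K α w = word K w.toList := by
  have h : ∀ w : FreeMonoid α, FreeAlgebra.equivMonoidAlgebraFreeMonoid (R := K) (X := α)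
      (word K w.toList) = MonoidAlgebra.of K (FreeMonoid α) w := by
    intro w
    induction w using FreeMonoid.recOn with
    | one => simp [MonoidAlgebra.one_def]
    | of_mul p w ih =>
      rw [FreeMonoid.toList_of_mul, word_cons, map_mul, ih, map_mul]
      congr 1
      simp [FreeAlgebra.equivMonoidAlgebraFreeMonoid]
  apply (FreeAlgebra.equivMonoidAlgebraFreeMonoid (R := K) (X := α)).injective
  rw [h w]
  simp [FreeAlgebra.basisFreeMonoid]

/-- Two linear maps on the free algebra agree if they agree on the monomials. -/
lemma linearMap_ext_word {M : Type*} [AddCommMonoid M] [Module K M]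
    {φ ψ : FreeAlgebra K α →ₗ[K] M} (h : ∀ w, φ (word K w) = ψ (word K w)) : φ = ψ :=
  (FreeAlgebra.basisFreeMonoid K α).ext fun w => by
    rw [basisFreeMonoid_apply]; exact h _

variable (π : α → ZMod 2)

/-- The parity of a word: the sum of the parities of its letters. -/
def wordParity (w : List α) : ZMod 2 := (w.map π).sum

@[simp] lemma wordParity_nil : wordParity π [] = 0 := rfl

@[simp] lemma wordParity_cons (p : α) (w : List α) :
    wordParity π (p :: w) = π p + wordParity π w := by
  simp [wordParity]

@[simp] lemma wordParity_append (u v : List α) :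
    wordParity π (u ++ v) = wordParity π u + wordParity π v := by
  simp [wordParity]

/-- Adds `s` to the state of every letter of a multiset of letters with states. -/
def shift (s : ZMod 2) : (α × ZMod 2 →₀ ℕ) →+ (α × ZMod 2 →₀ ℕ) :=
  Finsupp.mapDomain.addMonoidHom fun q => (q.1, q.2 + s)

@[simp] lemma shift_single (s : ZMod 2) (q : α × ZMod 2) (m : ℕ) :
    shift s (Finsupp.single q m) = Finsupp.single (q.1, q.2 + s) m :=
  Finsupp.mapDomain_single

@[simp] lemma shift_shift (s t : ZMod 2) (d : α × ZMod 2 →₀ ℕ) :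
    shift s (shift t d) = shift (t + s) d := by
  simp only [shift, Finsupp.mapDomain.addMonoidHom_apply, ← Finsupp.mapDomain_comp]
  congr 1
  funext q
  simp [add_assoc]

@[simp] lemma shift_zero (d : α × ZMod 2 →₀ ℕ) : shift 0 d = d := by
  simp only [shift, Finsupp.mapDomain.addMonoidHom_apply, add_zero]
  exact Finsupp.mapDomain_id

lemma shift_injective (s : ZMod 2) : Function.Injective (shift (α := α) s) := fun d e h => by
  simpa [← two_mul, show (2 : ZMod 2) = 0 from rfl] using congrArg (shift s) h

/-- The multiset of the letters of a word, each with its state, which is the parity of the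
prefix before it. -/
def wordData : List α → (α × ZMod 2 →₀ ℕ)
  | [] => 0
  | p :: w => Finsupp.single (p, 0) 1 + shift (π p) (wordData w)

@[simp] lemma wordData_nil : wordData π [] = 0 := rfl

@[simp] lemma wordData_cons (p : α) (w : List α) :
    wordData π (p :: w) = Finsupp.single (p, 0) 1 + shift (π p) (wordData π w) := rfl

@[simp] lemma wordData_append (u v : List α) :
    wordData π (u ++ v) = wordData π u + shift (wordParity π u) (wordData π v) := by
  induction u with
  | nil => simp
  | cons p u ih =>
    simp only [List.cons_append, wordData_cons, ih, map_add, shift_shift, wordParity_cons]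
    rw [add_assoc, add_comm (wordParity π u)]

lemma wordData_eq_zero {w : List α} (h : wordData π w = 0) : w = [] := by
  cases w with
  | nil => rfl
  | cons p w =>
    have := DFunLike.congr_fun h (p, 0)
    simp at this

/-- A letter occurs in the data of a word exactly if it occurs in the word in that state. -/
lemma exists_of_wordData_ne_zero {w : List α} {p : α} {s : ZMod 2}
    (h : wordData π w (p, s) ≠ 0) : ∃ u v, w = u ++ p :: v ∧ wordParity π u = s := by
  classical
  induction w generalizing s with
  | nil => simp at h
  | cons r w ih =>
    by_cases hr : r = p ∧ s = 0
    · exact ⟨[], w, by simp [hr.1], by simp [hr.2]⟩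
    -- Removing the first letter `r` lowers the remaining states by `π r`, and modulo 2 this is the
    -- same as adding it.
    · have h1 : wordData π w (p, s + π r) ≠ 0 := by
        have h2 : (shift (π r) (wordData π w)) (p, s) = wordData π w (p, s + π r) := by
          have hi : Function.Injective fun q : α × ZMod 2 => (q.1, q.2 + π r) := by
            rintro ⟨a, b⟩ ⟨c, d⟩ hh
            simpa using hh
          have h3 := Finsupp.mapDomain_apply hi (wordData π w) (p, s + π r)
          rw [← h3]
          have : ∀ s t : ZMod 2, s = s + t + t := by decide
          simp [shift, Finsupp.mapDomain.addMonoidHom_apply, ← this s (π r)]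
        have h4 : Finsupp.single (r, (0 : ZMod 2)) 1 (p, s) = 0 := by
          rw [Finsupp.single_apply, if_neg]
          rintro ⟨⟩
          exact hr ⟨rfl, rfl⟩
        rw [wordData_cons, Finsupp.add_apply, h4, zero_add, h2] at h
        exact h
      obtain ⟨u, v, rfl, hu⟩ := ih h1
      refine ⟨r :: u, v, rfl, ?_⟩
      have : ∀ s t : ZMod 2, t + (s + t) = s := by decide
      simp [hu, this]

lemma wordData_ne_zero (u v : List α) (p : α) :
    wordData π (u ++ p :: v) (p, wordParity π u) ≠ 0 := by
  simp

/-- A subspace of the free algebra that does not distinguish monomials that arise from each other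
by swapping adjacent even factors or by reversing three adjacent odd factors. -/
structure IsSwapClosed (J : Submodule K (FreeAlgebra K α)) : Prop where
  even : ∀ p a b q : List α, wordParity π a = 0 → wordParity π b = 0 →
    word K (p ++ (a ++ (b ++ q))) - word K (p ++ (b ++ (a ++ q))) ∈ J
  odd : ∀ p a b c q : List α, wordParity π a = 1 → wordParity π b = 1 → wordParity π c = 1 →
    word K (p ++ (a ++ (b ++ (c ++ q)))) - word K (p ++ (c ++ (b ++ (a ++ q)))) ∈ J

variable {K π}

/-- A common first letter can be arranged by one move and then transferred to the prefix `p`, which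
leaves shorter words with equal data. The prefix is carried along because `J` need not be an ideal.
-/
lemma IsSwapClosed.sub_mem_of_append {J : Submodule K (FreeAlgebra K α)}
    (hJ : IsSwapClosed K π J) (w : List α) : ∀ (w' p : List α), wordData π w = wordData π w' →
      word K (p ++ w) - word K (p ++ w') ∈ J := by
  induction hm : w.length using Nat.strong_induction_on generalizing w with
  | _ m ih =>
  have hz : ∀ t : ZMod 2, t ≠ 0 → t = 1 := by decide
  intro w' p h
  -- An even letter in state 0 follows an even prefix in both words, so an even swap brings it to
  -- the front of each. If there is none, all letters in state 0 are odd.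
  by_cases he : ∃ e, π e = 0 ∧ wordData π w (e, 0) ≠ 0
  · obtain ⟨e, he, hw⟩ := he
    obtain ⟨u, v, rfl, hu⟩ := exists_of_wordData_ne_zero π hw
    obtain ⟨u', v', rfl, hu'⟩ := exists_of_wordData_ne_zero π (h ▸ hw)
    have h1 := hJ.even p u [e] v hu (by simpa using he)
    have h2 := hJ.even p u' [e] v' hu' (by simpa using he)
    have h3 := ih (u ++ v).length (by simp [← hm]) (u ++ v) rfl (u' ++ v') (p ++ [e]) (by
      simp only [wordData_append, wordData_cons, hu, hu', he, shift_zero] at h ⊢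
      apply add_left_cancel (a := Finsupp.single (e, 0) 1)
      rw [add_left_comm, h, add_left_comm])
    have := J.sub_mem (J.add_mem h1 h3) h2
    convert this using 1
    simp only [List.append_assoc, List.singleton_append]
    abel
  · push Not at he
    cases w with
    | nil =>
      rw [wordData_eq_zero π (h.symm.trans (wordData_nil π)), sub_self]
      exact J.zero_mem
    | cons x q =>
      have hodd : ∀ y, wordData π (x :: q) (y, 0) ≠ 0 → π y = 1 := fun y hy =>
        hz _ fun h0 => hy (he y h0)
      have hx0 : wordData π (x :: q) (x, 0) ≠ 0 := wordData_ne_zero π [] q x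
      have hx := hodd x hx0
      obtain ⟨u, r, rfl, hu⟩ := exists_of_wordData_ne_zero π (h ▸ hx0)
      cases u with
      | nil =>
        have h3 := ih q.length (by simp [← hm]) q rfl r (p ++ [x]) (by
          simp only [List.nil_append, wordData_cons] at h
          exact shift_injective _ (add_left_cancel h))
        simpa using h3
      | cons y s =>
        have hy := hodd y (h ▸ wordData_ne_zero π [] (s ++ x :: r) y)
        have hs : wordParity π s = 1 := by
          rw [wordParity_cons, hy] at hu
          revert hu
          generalize wordParity π s = t
          revert t
          decide
        -- The second word is `y s x r` with `y`, `s`, `x` odd; reversing these three factors puts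
        -- `x` in front.
        have h1 := hJ.odd p [y] s [x] r (by simpa using hy) hs (by simpa using hx)
        have h3 := ih q.length (by simp [← hm]) q rfl (s ++ y :: r) (p ++ [x]) (by
          apply shift_injective (π x)
          apply add_left_cancel (a := Finsupp.single (x, 0) 1)
          rw [← wordData_cons, h]
          simp only [List.cons_append, wordData_append, wordData_cons, hx, hy, hs, map_add,
            shift_single, shift_shift]
          simp only [show (1 : ZMod 2) + 1 = 0 from rfl, zero_add]
          abel)
        have := J.sub_mem h3 h1
        convert this using 1
        simp only [List.append_assoc, List.cons_append, List.nil_append]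
        abel

lemma IsSwapClosed.sub_mem {J : Submodule K (FreeAlgebra K α)} (hJ : IsSwapClosed K π J)
    {w w' : List α} (h : wordData π w = wordData π w') : word K w - word K w' ∈ J :=
  hJ.sub_mem_of_append w w' [] h

variable (K π) in
/-- The linear map that sends each monomial to its data. -/
def dataMap : FreeAlgebra K α →ₗ[K] ((α × ZMod 2 →₀ ℕ) →₀ K) :=
  (FreeAlgebra.basisFreeMonoid K α).constr K fun w => Finsupp.single (wordData π w.toList) 1

@[simp] lemma dataMap_word (w : List α) :
    dataMap K π (word K w) = Finsupp.single (wordData π w) 1 := by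
  have := (FreeAlgebra.basisFreeMonoid K α).constr_basis K
    (fun w => Finsupp.single (wordData π w.toList) (1 : K)) (FreeMonoid.ofList w)
  rwa [basisFreeMonoid_apply] at this

lemma exists_of_dataMap_ne_zero {f : FreeAlgebra K α} {d : α × ZMod 2 →₀ ℕ}
    (h : dataMap K π f d ≠ 0) : ∃ w, wordData π w = d := by
  by_contra hd
  have : Finsupp.lapply d ∘ₗ dataMap K π = 0 := linearMap_ext_word K fun w => by
    have : wordData π w ≠ d := fun h => hd ⟨w, h⟩
    simp [this]
  exact h (LinearMap.congr_fun this f)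

variable (π) in
/-- Some word with the given data, if there is one. -/
def wordOfData : (α × ZMod 2 →₀ ℕ) → List α := Function.invFun (wordData π)

lemma wordData_wordOfData (w : List α) : wordData π (wordOfData π (wordData π w)) = wordData π w :=
  Function.invFun_eq ⟨w, rfl⟩

/-- Modulo `J` each word may be replaced by the chosen representative of its data, so `f` depends
only on `dataMap K π f`. -/
lemma IsSwapClosed.sub_linearCombination_mem {J : Submodule K (FreeAlgebra K α)}
    (hJ : IsSwapClosed K π J) (f : FreeAlgebra K α) :
    f - Finsupp.linearCombination K (fun d => word K (wordOfData π d)) (dataMap K π f) ∈ J := by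
  have : J.mkQ ∘ₗ (LinearMap.id - Finsupp.linearCombination K
      (fun d => word K (wordOfData π d)) ∘ₗ dataMap K π) = 0 := linearMap_ext_word K fun w => by
    simpa [sub_eq_zero, Submodule.Quotient.eq] using hJ.sub_mem (wordData_wordOfData w).symm
  have h := LinearMap.congr_fun this f
  rwa [LinearMap.comp_apply, Submodule.mkQ_apply, LinearMap.zero_apply,
    Submodule.Quotient.mk_eq_zero] at h

lemma IsSwapClosed.mem_of_dataMap_eq_zero {J : Submodule K (FreeAlgebra K α)}
    (hJ : IsSwapClosed K π J) {f : FreeAlgebra K α} (hf : dataMap K π f = 0) : f ∈ J := by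
  simpa [hf] using hJ.sub_linearCombination_mem f

/-- The parity of a multiset of letters with states. -/
def dataParity (π : α → ZMod 2) : (α × ZMod 2 →₀ ℕ) →+ ZMod 2 :=
  (Finsupp.linearCombination ℕ fun q : α × ZMod 2 => π q.1).toAddMonoidHom

@[simp] lemma dataParity_single (q : α × ZMod 2) : dataParity π (Finsupp.single q 1) = π q.1 := by
  simp [dataParity]

@[simp] lemma dataParity_shift (s : ZMod 2) (d : α × ZMod 2 →₀ ℕ) :
    dataParity π (shift s d) = dataParity π d := by
  simp [dataParity, shift, Finsupp.mapDomain.addMonoidHom_apply,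
    Finsupp.linearCombination_mapDomain, Function.comp_def]

@[simp] lemma dataParity_wordData (w : List α) : dataParity π (wordData π w) = wordParity π w := by
  induction w with
  | nil => simp
  | cons p w ih => simp [ih]

/-- A word of even parity whose data, with all states flipped, is again the data of a word, is
empty or a product of two odd words. -/
lemma exists_odd_append {w w' : List α} (hw : wordParity π w = 0)
    (h : wordData π w' = shift 1 (wordData π w)) (hne : w ≠ []) :
    ∃ a b, w = a ++ b ∧ wordParity π a = 1 ∧ wordParity π b = 1 := by
  cases w' with
  | nil =>
    refine absurd (wordData_eq_zero π (shift_injective 1 ?_)) hne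
    rw [← h, wordData_nil, map_zero]
  | cons x v =>
    have h1 : wordData π w = shift 1 (wordData π (x :: v)) := by
      rw [h, shift_shift, show (1 : ZMod 2) + 1 = 0 from rfl, shift_zero]
    -- The first letter `x` of `w'` has state 0 there, hence state 1 in `w`: it is preceded by an
    -- odd prefix.
    obtain ⟨a, b, rfl, ha⟩ := exists_of_wordData_ne_zero π (w := w) (p := x) (s := 1) (by
      rw [h1]; simp)
    refine ⟨a, x :: b, rfl, ha, ?_⟩
    rw [wordParity_append, ha] at hw
    revert hw
    generalize wordParity π (x :: b) = t
    revert t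
    decide

/-- An element of the free algebra whose data are supported in even parity and invariant under the
flip of the states lies in every swap closed subspace that contains `1` and the anticommutators
of the odd words. -/
lemma IsSwapClosed.mem_of_dataMap_symm [NeZero (2 : K)] {J : Submodule K (FreeAlgebra K α)}
    (hJ : IsSwapClosed K π J) (h1 : 1 ∈ J)
    (hab : ∀ a b : List α, wordParity π a = 1 → wordParity π b = 1 →
      word K (a ++ b) + word K (b ++ a) ∈ J)
    {f : FreeAlgebra K α} (hodd : ∀ d, dataParity π d = 1 → dataMap K π f d = 0)
    (hsymm : ∀ d, dataParity π d = 0 → dataMap K π f d = dataMap K π f (shift 1 d)) : f ∈ J := by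
  have hz : ∀ t : ZMod 2, t ≠ 1 → t = 0 := by decide
  have h11 : (1 : ZMod 2) + 1 = 0 := rfl
  set Ψ := Finsupp.linearCombination K (fun d => word K (wordOfData π d)) with hΨ
  have hsymm' : ∀ d, dataMap K π f d = dataMap K π f (shift 1 d) := fun d => by
    by_cases hd : dataParity π d = 1
    · rw [hodd d hd, hodd _ (by simpa using hd)]
    · exact hsymm d (hz _ hd)
  have hflip : Finsupp.mapDomain (shift 1) (dataMap K π f) = dataMap K π f := by
    ext d
    have := Finsupp.mapDomain_apply (shift_injective (α := α) 1) (dataMap K π f) (shift 1 d)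
    rw [shift_shift, h11, shift_zero] at this
    rw [this, ← hsymm' d]
  -- By the symmetry one of the two copies may be reindexed by the flip, which pairs each
  -- representative word with one of flipped data.
  have hsum : Ψ (dataMap K π f) + Ψ (dataMap K π f) ∈ J := by
    conv => enter [2, 2, 2]; rw [← hflip]
    rw [hΨ, Finsupp.linearCombination_mapDomain, Finsupp.linearCombination_apply,
      Finsupp.linearCombination_apply, ← Finsupp.sum_add]
    refine Submodule.sum_mem _ fun d hd => ?_
    rw [Finsupp.mem_support_iff] at hd
    beta_reduce
    rw [← smul_add]
    refine J.smul_mem _ ?_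
    have hpar : dataParity π d = 0 := hz _ fun h => hd (hodd d h)
    obtain ⟨w₁, rfl⟩ := exists_of_dataMap_ne_zero hd
    obtain ⟨w₂, hw₂⟩ := exists_of_dataMap_ne_zero (hsymm' _ ▸ hd)
    simp only [Function.comp_apply]
    have e1 := wordData_wordOfData (π := π) w₁
    have e2 := wordData_wordOfData (π := π) w₂
    rw [hw₂] at e2
    generalize wordOfData π (wordData π w₁) = v₁ at e1 ⊢
    generalize wordOfData π (shift 1 (wordData π w₁)) = v₂ at e2 ⊢
    rw [← e1] at e2 hpar
    rw [dataParity_wordData] at hpar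
    by_cases hne : v₁ = []
    · subst hne
      have : v₂ = [] := wordData_eq_zero π (by simpa using e2)
      subst this
      exact J.add_mem h1 h1
    · obtain ⟨a, b, rfl, ha, hb⟩ := exists_odd_append hpar e2 hne
      have h3 : wordData π v₂ = wordData π (b ++ a) := by
        rw [e2]
        simp [ha, hb, h11, add_comm]
      have := J.add_mem (hab a b ha hb) (hJ.sub_mem h3)
      convert this using 1
      abel
  have h2 : Ψ (dataMap K π f) ∈ J := by
    rw [← two_smul K] at hsum
    exact (J.smul_mem_iff (NeZero.ne (2 : K))).1 hsum
  exact (J.sub_mem_iff_left h2).1 (hJ.sub_linearCombination_mem f)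

end Words

/-! ### Generic matrices and their coefficients -/

section Generic

open MvPolynomial

/-- The point that assigns `z p` to the variable `(p, 0)` and its conjugate to `(p, 1)`. -/
def conjPoint {α : Type*} (z : α → ℂ) (q : α × ZMod 2) : ℂ :=
  if q.2 = 0 then z q.1 else star (z q.1)

/-- A complex polynomial in variables and their conjugates that vanishes as a function is zero. -/
lemma eq_zero_of_eval_conjPoint {α : Type*} (P : MvPolynomial (α × ZMod 2) ℂ)
    (h : ∀ z : α → ℂ, eval (conjPoint z) P = 0) : P = 0 := by
  set Q : MvPolynomial (α × ZMod 2) ℂ := bind₁ (fun q => if q.2 = 0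
    then X (q.1, 0) + C Complex.I * X (q.1, 1) else X (q.1, 0) - C Complex.I * X (q.1, 1)) P
    with hQ
  have heval : ∀ y, eval y Q = eval (fun q => if q.2 = 0
      then y (q.1, 0) + Complex.I * y (q.1, 1) else y (q.1, 0) - Complex.I * y (q.1, 1)) P := by
    intro y
    rw [hQ]
    refine (eval₂Hom_bind₁ _ _ _ P).trans ?_
    change eval _ P = _
    congr 2
    funext q
    split_ifs <;> simp
  -- `Q` is `P` written in real and imaginary parts; it vanishes at all real points, and `ℝ` is
  -- infinite.
  have hQ0 : Q = 0 := by
    refine funext_set (fun _ => Set.range ((↑) : ℝ → ℂ))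
      (fun _ => Set.infinite_range_of_injective Complex.ofReal_injective) fun y hy => ?_
    choose r hr using fun q => hy q trivial
    rw [heval, map_zero, ← h fun p => r (p, 0) + Complex.I * r (p, 1)]
    congr 2
    funext q
    simp only [conjPoint, ← hr]
    split_ifs <;> simp [sub_eq_add_neg]
  refine MvPolynomial.funext fun y => ?_
  -- The inverse of the linear substitution that defines `Q`, taken at arbitrary complex values.
  have := heval fun q => if q.2 = 0 then (y (q.1, 0) + y (q.1, 1)) / 2
    else (y (q.1, 0) - y (q.1, 1)) / (2 * Complex.I)
  rw [hQ0, map_zero] at this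
  rw [map_zero, this]
  congr 2
  funext ⟨p, s⟩
  have hI := Complex.I_ne_zero
  have hs : ∀ s : ZMod 2, s = 0 ∨ s = 1 := by decide
  rcases hs s with rfl | rfl
  · simp
    field_simp
    ring
  · simp
    field_simp
    ring

variable {α : Type*} (π : α → ZMod 2) (N : α → ℕ) (μ : ℂ)

/-- The generic matrix for a letter: in row `i` its only entry is `μ ^ N p` times the variable
`(p, i)`, in column `i + π p`. -/
def genericMatrix (p : α) : Matrix (ZMod 2) (ZMod 2) (MvPolynomial (α × ZMod 2) ℂ) :=
  Matrix.of fun i j => if j = i + π p then C (μ ^ N p) * X (p, i) else 0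

/-- The evaluation of an element of the free algebra at the generic matrices. -/
def genericEval : FreeAlgebra ℝ α →ₐ[ℝ] Matrix (ZMod 2) (ZMod 2) (MvPolynomial (α × ZMod 2) ℂ) :=
  FreeAlgebra.lift ℝ (genericMatrix π N μ)

/-- The total weight of a multiset of letters with states. -/
def dataWeight : (α × ZMod 2 →₀ ℕ) →+ ℕ :=
  (Finsupp.linearCombination ℕ fun q : α × ZMod 2 => N q.1).toAddMonoidHom

@[simp] lemma dataWeight_single (q : α × ZMod 2) : dataWeight N (Finsupp.single q 1) = N q.1 := by
  simp [dataWeight]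

@[simp] lemma dataWeight_shift (s : ZMod 2) (d : α × ZMod 2 →₀ ℕ) :
    dataWeight N (shift s d) = dataWeight N d := by
  simp [dataWeight, shift, Finsupp.mapDomain.addMonoidHom_apply,
    Finsupp.linearCombination_mapDomain, Function.comp_def]

/-- Each generic matrix has one nonzero entry per row, so only one path starts in row `i`; a letter
of state `s` is met in row `i + s`. -/
lemma genericEval_word (w : List α) (i j : ZMod 2) :
    genericEval π N μ (word ℝ w) i j = if j = i + wordParity π w then
      monomial (shift i (wordData π w)) (μ ^ dataWeight N (wordData π w)) else 0 := by
  induction w generalizing i with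
  | nil => simp [Matrix.one_apply, eq_comm]
  | cons p w ih =>
    rw [word_cons, map_mul, Matrix.mul_apply, Finset.sum_eq_single (i + π p)]
    · rw [ih]
      simp only [genericEval, FreeAlgebra.lift_ι_apply, genericMatrix, Matrix.of_apply, if_true,
        wordParity_cons, add_assoc, mul_ite, mul_zero]
      congr 1
      rw [wordData_cons, map_add, map_add, shift_shift, shift_single, dataWeight_single,
        dataWeight_shift, X, C_mul_monomial, monomial_mul, mul_one, ← pow_add, zero_add,
        add_comm i]
    · intro k _ hk
      simp [genericEval, genericMatrix, hk]
    · simp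

lemma coeff_genericEval (f : FreeAlgebra ℝ α) (d : α × ZMod 2 →₀ ℕ) (i j : ZMod 2) :
    coeff (shift i d) (genericEval π N μ f i j) =
      if j = i + dataParity π d then (dataMap ℝ π f d : ℂ) * μ ^ dataWeight N d else 0 := by
  let φ : FreeAlgebra ℝ α →ₗ[ℝ] ℂ :=
    { toFun := fun f => coeff (shift i d) (genericEval π N μ f i j)
      map_add' := fun f g => by simp
      map_smul' := fun r f => by simp }
  let ψ : FreeAlgebra ℝ α →ₗ[ℝ] ℂ :=
    { toFun := fun f =>
        if j = i + dataParity π d then (dataMap ℝ π f d : ℂ) * μ ^ dataWeight N d else 0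
      map_add' := fun f g => by split_ifs <;> simp [add_mul]
      map_smul' := fun r f => by split_ifs <;> simp [mul_assoc] }
  have : φ = ψ := linearMap_ext_word ℝ fun w => by
    classical
    change coeff (shift i d) (genericEval π N μ (word ℝ w) i j) = if j = i + dataParity π d
      then (dataMap ℝ π (word ℝ w) d : ℂ) * μ ^ dataWeight N d else 0
    rw [genericEval_word, dataMap_word]
    by_cases hd : wordData π w = d
    · subst hd
      split_ifs with h1 h2 h2
      · simp
      · simp [h1] at h2
      · simp [h2] at h1
      · simp
    · split_ifs <;> simp [hd, (shift_injective i).eq_iff]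
  exact LinearMap.congr_fun this f

variable {π N μ}

lemma dataMap_eq_zero_of_genericEval (hμ : μ ≠ 0) {f : FreeAlgebra ℝ α}
    (hf : genericEval π N μ f = 0) : dataMap ℝ π f = 0 := by
  ext d
  have := coeff_genericEval π N μ f d 0 (0 + dataParity π d)
  simpa [hf, hμ] using this

lemma sum_zmod_two {M : Type*} [AddCommMonoid M] (F : ZMod 2 → M) : ∑ i, F i = F 0 + F 1 :=
  Fin.sum_univ_two F

/-- The matrix of `p` is diagonal with distinct entries, so a matrix commuting with it has zero
off-diagonal entries, where the odd data are recorded. The letter `p` may occur in `f`. -/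
lemma dataMap_eq_zero_of_odd (hμ : μ ≠ 0) {f : FreeAlgebra ℝ α} {p : α} (hp : π p = 0)
    (hf : genericEval π N μ (f * FreeAlgebra.ι ℝ p - FreeAlgebra.ι ℝ p * f) = 0)
    {d : α × ZMod 2 →₀ ℕ} (hd : dataParity π d = 1) : dataMap ℝ π f d = 0 := by
  have h01 : genericEval π N μ f 0 1 * (X (p, 1) - X (p, 0)) = 0 := by
    have := congrFun (congrFun hf 0) 1
    simp only [map_sub, map_mul, Matrix.sub_apply, Matrix.mul_apply, sum_zmod_two] at this
    simp only [genericEval, FreeAlgebra.lift_ι_apply, genericMatrix, Matrix.of_apply, hp,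
      add_zero, if_true, one_ne_zero, if_false, mul_zero, zero_mul, zero_add,
      Matrix.zero_apply] at this
    have hC : (C (μ ^ N p) : MvPolynomial (α × ZMod 2) ℂ) ≠ 0 := by simp [hμ]
    refine (mul_eq_zero.1 ?_).resolve_left hC
    rw [← this]
    simp only [genericEval]
    ring
  have hX : (X (p, 1) - X (p, 0) : MvPolynomial (α × ZMod 2) ℂ) ≠ 0 := by
    rw [sub_ne_zero]
    intro h
    simpa using X_injective h
  have := coeff_genericEval π N μ f d 0 1
  simpa [(mul_eq_zero.1 h01).resolve_right hX, hd, hμ] using this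

/-- The matrix of `p` is antidiagonal, so commuting with it forces equal diagonal entries; rows 0
and 1 record the data with opposite states. -/
lemma dataMap_eq_of_even (hμ : μ ≠ 0) {f : FreeAlgebra ℝ α} {p : α} (hp : π p = 1)
    (hf : genericEval π N μ (f * FreeAlgebra.ι ℝ p - FreeAlgebra.ι ℝ p * f) = 0)
    {d : α × ZMod 2 →₀ ℕ} (hd : dataParity π d = 0) :
    dataMap ℝ π f d = dataMap ℝ π f (shift 1 d) := by
  have h11 : (1 : ZMod 2) + 1 = 0 := rfl
  have h01 : genericEval π N μ f 0 0 = genericEval π N μ f 1 1 := by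
    have := congrFun (congrFun hf 0) 1
    simp only [map_sub, map_mul, Matrix.sub_apply, Matrix.mul_apply, sum_zmod_two] at this
    simp only [genericEval, FreeAlgebra.lift_ι_apply, genericMatrix, Matrix.of_apply, hp,
      add_zero, if_true, one_ne_zero, zero_ne_one, if_false, mul_zero, zero_mul, zero_add,
      Matrix.zero_apply, h11] at this
    have hC : (C (μ ^ N p) * X (p, 0) : MvPolynomial (α × ZMod 2) ℂ) ≠ 0 :=
      mul_ne_zero (by simp [hμ]) (X_ne_zero _)
    apply mul_left_cancel₀ hC
    rw [← sub_eq_zero, ← this]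
    simp only [genericEval]
    ring
  have h0 := coeff_genericEval π N μ f d 0 0
  have h1 := coeff_genericEval π N μ f (shift 1 d) 1 1
  rw [shift_shift, h11, dataParity_shift, dataWeight_shift, ← h01, h0] at h1
  simpa [hd, hμ] using h1

end Generic

/-! ### Graded substitutions, `T_G`-ideals and `T_G`-spaces -/

section TSpaces

variable {K : Type*} [Field K] {G : Type*} [AddCommMonoid G]

/-- The degree of a monomial. -/
def wordDegree (w : List (ℕ × G)) : G := (w.map Prod.snd).sum

lemma word_mem_freeComponent (w : List (ℕ × G)) : word K w ∈ freeComponent K (wordDegree w) :=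
  Submodule.subset_span ⟨w, rfl, rfl⟩

variable {A : Type*} [Ring A] [Algebra K A]

/-- An algebra map sends homogeneous elements to homogeneous elements if it does so on the
variables. -/
lemma lift_mem_of_mem_freeComponent {𝒜 : G → Submodule K A} [SetLike.GradedMonoid 𝒜]
    {a : ℕ × G → A} (ha : IsAdmissible 𝒜 a) {g : G} {f : FreeGradedAlgebra K G}
    (hf : f ∈ freeComponent K g) : FreeAlgebra.lift K a f ∈ 𝒜 g := by
  have : freeComponent K g ≤ (𝒜 g).comap (FreeAlgebra.lift K a).toLinearMap := by
    refine Submodule.span_le.2 ?_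
    rintro _ ⟨w, rfl, rfl⟩
    have := SetLike.list_prod_map_mem_graded (A := 𝒜) w Prod.snd a fun p _ => ha p
    simpa [map_list_prod, Function.comp_def] using this
  exact this hf

instance : SetLike.GradedMonoid (freeComponent K : G → Submodule K (FreeGradedAlgebra K G)) where
  one_mem := word_mem_freeComponent []
  mul_mem i j f g hf hg := by
    refine Submodule.span_induction₂ (p := fun f g _ _ => f * g ∈ freeComponent K (i + j))
      ?_ ?_ ?_ ?_ ?_ ?_ ?_ hf hg
    · rintro _ _ ⟨u, rfl, rfl⟩ ⟨v, rfl, rfl⟩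
      exact Submodule.subset_span ⟨u ++ v, by simp, by simp⟩
    · simp
    · simp
    · intro f g h _ _ _ h1 h2
      simpa [add_mul] using add_mem h1 h2
    · intro f g h _ _ _ h1 h2
      simpa [mul_add] using add_mem h1 h2
    · intro r f g _ _ h1
      simpa using Submodule.smul_mem _ r h1
    · intro r f g _ _ h1
      simpa using Submodule.smul_mem _ r h1

lemma isGradedEnd_lift {a : ℕ × G → FreeGradedAlgebra K G} (ha : IsAdmissible (freeComponent K) a) :
    IsGradedEnd (FreeAlgebra.lift K a) :=
  fun _ _ hf => lift_mem_of_mem_freeComponent ha hf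

lemma ι_mem_freeComponent (p : ℕ × G) : FreeAlgebra.ι K p ∈ freeComponent K p.2 := by
  simpa [wordDegree] using word_mem_freeComponent (K := K) [p]

lemma lift_comp_gradedEnd {𝒜 : G → Submodule K A} [SetLike.GradedMonoid 𝒜] {a : ℕ × G → A}
    (ha : IsAdmissible 𝒜 a) {φ : FreeGradedAlgebra K G →ₐ[K] FreeGradedAlgebra K G}
    (hφ : IsGradedEnd φ) : ∃ b, IsAdmissible 𝒜 b ∧
      ∀ f, FreeAlgebra.lift K a (φ f) = FreeAlgebra.lift K b f := by
  refine ⟨fun p => FreeAlgebra.lift K a (φ (FreeAlgebra.ι K p)),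
    fun p => lift_mem_of_mem_freeComponent ha (hφ _ _ (ι_mem_freeComponent p)), fun f => ?_⟩
  have : (FreeAlgebra.lift K a).comp φ =
      FreeAlgebra.lift K fun p => FreeAlgebra.lift K a (φ (FreeAlgebra.ι K p)) :=
    FreeAlgebra.hom_ext (by funext p; simp)
  exact DFunLike.congr_fun this f

/-- The graded identities as a subspace. -/
def gradedIdentitiesSubmodule (𝒜 : G → Submodule K A) : Submodule K (FreeGradedAlgebra K G) where
  carrier := gradedIdentities 𝒜
  add_mem' hf hg a ha := by rw [map_add, hf a ha, hg a ha, add_zero]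
  zero_mem' a _ := map_zero _
  smul_mem' r f hf a ha := by rw [map_smul, hf a ha, smul_zero]

/-- The graded central polynomials as a subspace. -/
def gradedCentralSubmodule (𝒜 : G → Submodule K A) : Submodule K (FreeGradedAlgebra K G) where
  carrier := gradedCentralPolynomials 𝒜
  add_mem' hf hg a ha := by rw [map_add]; exact add_mem (hf a ha) (hg a ha)
  zero_mem' a _ := by rw [map_zero]; exact zero_mem _
  smul_mem' r f hf a ha := by
    rw [map_smul]; exact (Subalgebra.center K A).smul_mem (hf a ha) r

lemma isTIdeal_gradedIdentities (𝒜 : G → Submodule K A) [SetLike.GradedMonoid 𝒜] :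
    IsTIdeal (gradedIdentitiesSubmodule 𝒜) := by
  refine ⟨fun φ hφ f hf a ha => ?_, fun f hf p => ⟨fun a ha => ?_, fun a ha => ?_⟩⟩
  · obtain ⟨b, hb, h⟩ := lift_comp_gradedEnd ha hφ
    rw [h, hf b hb]
  · rw [map_mul, hf a ha, mul_zero]
  · rw [map_mul, hf a ha, zero_mul]

lemma isTSpace_gradedCentral (𝒜 : G → Submodule K A) [SetLike.GradedMonoid 𝒜] :
    IsTSpace (gradedCentralSubmodule 𝒜) := by
  intro φ hφ f hf a ha
  obtain ⟨b, hb, h⟩ := lift_comp_gradedEnd ha hφ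
  rw [h]
  exact hf b hb

lemma mul_ι_sub_mem_gradedIdentities {H : Type*} {𝒜 : H → Submodule K A}
    {f : FreeGradedAlgebra K H}
    (hf : f ∈ gradedCentralPolynomials 𝒜) (p : ℕ × H) :
    f * FreeAlgebra.ι K p - FreeAlgebra.ι K p * f ∈ gradedIdentities 𝒜 := by
  intro a ha
  rw [map_sub, map_mul, map_mul, sub_eq_zero]
  exact (Subalgebra.mem_center_iff.1 (hf a ha) _).symm

lemma isTIdealBasis_of {S : Set (FreeGradedAlgebra K G)} {I : Submodule K (FreeGradedAlgebra K G)}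
    (hI : IsTIdeal I) (hS : S ⊆ I)
    (h : ∀ J : Submodule K (FreeGradedAlgebra K G), IsTIdeal J → S ⊆ J → I ≤ J) :
    IsTIdealBasis S (I : Set (FreeGradedAlgebra K G)) :=
  Set.Subset.antisymm
    (Set.subset_iInter fun J => Set.subset_iInter fun hJ => Set.subset_iInter fun hSJ => h J hJ hSJ)
    (Set.iInter_subset_of_subset I (Set.iInter_subset_of_subset hI (Set.iInter_subset _ hS)))

lemma isTSpaceBasis_of {S : Set (FreeGradedAlgebra K G)} {V : Submodule K (FreeGradedAlgebra K G)}
    (hV : IsTSpace V) (hS : S ⊆ V)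
    (h : ∀ W : Submodule K (FreeGradedAlgebra K G), IsTSpace W → S ⊆ W → V ≤ W) :
    IsTSpaceBasis S (V : Set (FreeGradedAlgebra K G)) :=
  Set.Subset.antisymm
    (Set.subset_iInter fun J => Set.subset_iInter fun hJ => Set.subset_iInter fun hSJ => h J hJ hSJ)
    (Set.iInter_subset_of_subset V (Set.iInter_subset_of_subset hV (Set.iInter_subset _ hS)))

/-- A `T_G`-space is closed under the substitution of monomials for variables of the same
degree. -/
lemma IsTSpace.exists_wordSubst {V : Submodule K (FreeGradedAlgebra K G)} (hV : IsTSpace V)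
    (l : ℕ → List (ℕ × G)) : ∃ φ : FreeGradedAlgebra K G →ₐ[K] FreeGradedAlgebra K G,
      (∀ f ∈ V, φ f ∈ V) ∧ ∀ i, φ (x K i (wordDegree (l i))) = word K (l i) := by
  classical
  -- Variables of any other degree go to 0, which is homogeneous of every degree.
  refine ⟨FreeAlgebra.lift K fun q => if wordDegree (l q.1) = q.2 then word K (l q.1) else 0,
    hV _ (isGradedEnd_lift fun q => ?_), fun i => by simp [x]⟩
  split_ifs with h
  · exact h ▸ word_mem_freeComponent _
  · exact zero_mem _

end TSpaces

/-! ### Parity in the cyclic group and consequences of the generators -/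

section Cyclic

variable {n : ℕ} (hn : 2 ∣ n)

/-- The parity of a letter. -/
def letterParity (p : ℕ × ZMod n) : ZMod 2 := ZMod.castHom hn (ZMod 2) p.2

lemma wordParity_letterParity (w : List (ℕ × ZMod n)) :
    wordParity (letterParity hn) w = ZMod.castHom hn (ZMod 2) (wordDegree w) := by
  rw [wordParity, wordDegree, map_list_sum, List.map_map]
  rfl

lemma castHom_eq_natCast_val [NeZero n] (g : ZMod n) :
    ZMod.castHom hn (ZMod 2) g = (g.val : ZMod 2) := by
  rw [ZMod.castHom_apply, ZMod.natCast_val]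

lemma even_iff_even_val {n : ℕ} (hn : 2 ∣ n) [NeZero n] (g : ZMod n) : Even g ↔ Even g.val := by
  constructor
  · rintro ⟨r, rfl⟩
    rw [← ZMod.natCast_eq_zero_iff_even, ← castHom_eq_natCast_val hn, map_add]
    generalize ZMod.castHom hn (ZMod 2) r = t
    revert t
    decide
  · intro h
    simpa using h.natCast (α := ZMod n)

lemma odd_iff_odd_val {n : ℕ} (hn : 2 ∣ n) [NeZero n] (g : ZMod n) : Odd g ↔ Odd g.val := by
  constructor
  · rintro ⟨r, rfl⟩
    rw [← ZMod.natCast_eq_one_iff_odd, ← castHom_eq_natCast_val hn, map_add, map_mul, map_one,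
      map_ofNat]
    generalize ZMod.castHom hn (ZMod 2) r = t
    revert t
    decide
  · intro h
    simpa using h.natCast (R := ZMod n)

lemma even_wordDegree [NeZero n] {w : List (ℕ × ZMod n)}
    (hw : wordParity (letterParity hn) w = 0) : Even (wordDegree w) := by
  rwa [even_iff_even_val hn, ← ZMod.natCast_eq_zero_iff_even, ← castHom_eq_natCast_val hn,
    ← wordParity_letterParity]

lemma odd_wordDegree [NeZero n] {w : List (ℕ × ZMod n)}
    (hw : wordParity (letterParity hn) w = 1) : Odd (wordDegree w) := by
  rwa [odd_iff_odd_val hn, ← ZMod.natCast_eq_one_iff_odd, ← castHom_eq_natCast_val hn,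
    ← wordParity_letterParity]

lemma isSwapClosed_of_isTIdeal [NeZero n] {J : Submodule ℝ (FreeGradedAlgebra ℝ (ZMod n))}
    (hJ : IsTIdeal J) (hS : evenCommutators n ∪ oddTriples n ⊆ J) :
    IsSwapClosed ℝ (letterParity hn) J where
  even p a b q ha hb := by
    -- Variables are numbered from 1; the empty word at index 0 is padding.
    obtain ⟨φ, hφ, h⟩ := hJ.1.exists_wordSubst fun i => [[], a, b].getD i []
    have := hφ _ (hS (Or.inl ⟨_, _, even_wordDegree hn ha, even_wordDegree hn hb, rfl⟩))
    have h1 := h 1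
    have h2 := h 2
    simp only [List.getD_cons_zero, List.getD_cons_succ] at h1 h2
    simp only [map_sub, map_mul, h1, h2] at this
    have := (hJ.2 _ ((hJ.2 _ this (word ℝ p)).1) (word ℝ q)).2
    convert this using 1
    simp only [word_append]
    noncomm_ring
  odd p a b c q ha hb hc := by
    obtain ⟨φ, hφ, h⟩ := hJ.1.exists_wordSubst fun i => [[], a, b, c].getD i []
    have := hφ _ (hS (Or.inr ⟨_, _, _, odd_wordDegree hn ha, odd_wordDegree hn hb,
      odd_wordDegree hn hc, rfl⟩))
    have h1 := h 1
    have h2 := h 2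
    have h3 := h 3
    simp only [List.getD_cons_zero, List.getD_cons_succ] at h1 h2 h3
    simp only [map_sub, map_mul, h1, h2, h3] at this
    have := (hJ.2 _ ((hJ.2 _ this (word ℝ p)).1) (word ℝ q)).2
    convert this using 1
    simp only [word_append]
    noncomm_ring

/-- A `T_G`-space cannot be multiplied by outer words, so the bordering variables take the values
`p` and `q`; either may be empty, as substitutions by 1 are allowed in degree 0. -/
lemma isSwapClosed_of_isTSpace [NeZero n] {W : Submodule ℝ (FreeGradedAlgebra ℝ (ZMod n))}
    (hW : IsTSpace W) (h₁ : borderedEvenCommutators n ⊆ W) (h₂ : borderedOddTriples n ⊆ W) :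
    IsSwapClosed ℝ (letterParity hn) W where
  even p a b q ha hb := by
    obtain ⟨φ, hφ, h⟩ := hW.exists_wordSubst fun i => [[], p, a, b, q].getD i []
    have := hφ _ (h₁ ⟨wordDegree p, _, _, wordDegree q, even_wordDegree hn ha,
      even_wordDegree hn hb, rfl⟩)
    have h1 := h 1
    have h2 := h 2
    have h3 := h 3
    have h4 := h 4
    simp only [List.getD_cons_zero, List.getD_cons_succ] at h1 h2 h3 h4
    simp only [map_sub, map_mul, h1, h2, h3, h4] at this
    convert this using 1
    simp only [word_append]
    noncomm_ring
  odd p a b c q ha hb hc := by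
    obtain ⟨φ, hφ, h⟩ := hW.exists_wordSubst fun i => [[], p, a, b, c, q].getD i []
    have := hφ _ (h₂ ⟨wordDegree p, _, _, _, wordDegree q, odd_wordDegree hn ha,
      odd_wordDegree hn hb, odd_wordDegree hn hc, rfl⟩)
    have h1 := h 1
    have h2 := h 2
    have h3 := h 3
    have h4 := h 4
    have h5 := h 5
    simp only [List.getD_cons_zero, List.getD_cons_succ] at h1 h2 h3 h4 h5
    simp only [map_sub, map_mul, h1, h2, h3, h4, h5] at this
    convert this using 1
    simp only [word_append]
    noncomm_ring

lemma word_append_add_mem_of_isTSpace [NeZero n] {W : Submodule ℝ (FreeGradedAlgebra ℝ (ZMod n))}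
    (hW : IsTSpace W) (hS : oddAnticommutators n ⊆ W) (a b : List (ℕ × ZMod n))
    (ha : wordParity (letterParity hn) a = 1) (hb : wordParity (letterParity hn) b = 1) :
    word ℝ (a ++ b) + word ℝ (b ++ a) ∈ W := by
  obtain ⟨φ, hφ, h⟩ := hW.exists_wordSubst fun i => [[], a, b].getD i []
  have := hφ _ (hS ⟨_, _, odd_wordDegree hn ha, odd_wordDegree hn hb, rfl⟩)
  have h1 := h 1
  have h2 := h 2
  simp only [List.getD_cons_zero, List.getD_cons_succ] at h1 h2
  simpa only [map_add, map_mul, h1, h2, word_append] using this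

end Cyclic

/-! ### The homogeneous components of the algebra; the generators hold in it -/

section Structure

/-- The embedding of `ℂ` in the matrices that sends `i` to `C`. -/
def complexMat : ℂ →ₐ[ℝ] Matrix (Fin 2) (Fin 2) ℂ :=
  Complex.lift ⟨matC, by ext i j; fin_cases i <;> fin_cases j <;> simp [matC, Matrix.mul_apply]⟩

lemma complexMat_apply (z : ℂ) : complexMat z = !![(z.re : ℂ), z.im; -z.im, z.re] := by
  ext i j
  fin_cases i <;> fin_cases j <;>
    simp [complexMat, Complex.liftAux_apply, matC, Matrix.algebraMap_matrix_apply]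

lemma complexMat_I : complexMat Complex.I = matC := by
  rw [complexMat_apply]; simp [matC]

variable (μ : ℂ)

/-- `A` anticommutes with `C`, the image of `i`. -/
lemma smul_matA_mul_complexMat (z : ℂ) :
    (μ • matA) * complexMat z = complexMat (star z) * (μ • matA) := by
  rw [complexMat_apply, complexMat_apply]
  ext i j
  fin_cases i <;> fin_cases j <;> simp [matA, Matrix.mul_apply, mul_comm]

lemma matA_sq : matA ^ 2 = 1 := by
  ext i j
  fin_cases i <;> fin_cases j <;> simp [matA, pow_two, Matrix.mul_apply]

lemma smul_matA_pow_even {m : ℕ} (hm : Even m) : (μ • matA) ^ m = μ ^ m • 1 := by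
  obtain ⟨r, rfl⟩ := hm
  rw [smul_pow, ← two_mul, pow_mul matA, matA_sq, one_pow]

lemma smul_matA_pow_mul_complexMat_of_even {m : ℕ} (hm : Even m) (z : ℂ) :
    (μ • matA) ^ m * complexMat z = complexMat z * (μ • matA) ^ m := by
  simp [smul_matA_pow_even μ hm]

lemma smul_matA_pow_mul_complexMat_of_odd {m : ℕ} (hm : Odd m) (z : ℂ) :
    (μ • matA) ^ m * complexMat z = complexMat (star z) * (μ • matA) ^ m := by
  obtain ⟨r, rfl⟩ := hm
  rw [pow_succ, mul_assoc, smul_matA_mul_complexMat, ← mul_assoc,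
    smul_matA_pow_mul_complexMat_of_even μ (even_two_mul r), mul_assoc]

lemma exists_smul_matA_pow_mul_complexMat (m : ℕ) (z : ℂ) :
    ∃ z', (μ • matA) ^ m * complexMat z = complexMat z' * (μ • matA) ^ m := by
  rcases Nat.even_or_odd m with h | h
  · exact ⟨_, smul_matA_pow_mul_complexMat_of_even μ h z⟩
  · exact ⟨_, smul_matA_pow_mul_complexMat_of_odd μ h z⟩

variable {n : ℕ}

/-- The matrices `M` for which `gʲ ⊗ M` lies in the algebra. -/
def matComponent (n : ℕ) (μ : ℂ) (j : ZMod n) : Submodule ℝ (Matrix (Fin 2) (Fin 2) ℂ) :=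
  LinearMap.range ((LinearMap.mulRight ℝ ((μ • matA) ^ j.val)) ∘ₗ complexMat.toLinearMap)

variable {μ}

lemma mem_matComponent {j : ZMod n} {M : Matrix (Fin 2) (Fin 2) ℂ} :
    M ∈ matComponent n μ j ↔ ∃ z, M = complexMat z * (μ • matA) ^ j.val := by
  simp [matComponent, eq_comm]

lemma complexMat_mul_pow_mem [NeZero n] (hn : 2 ∣ n) {ε : ℝ} (hμ : μ ^ n = ε) (z : ℂ) (m : ℕ) :
    complexMat z * (μ • matA) ^ m ∈ matComponent n μ (m : ZMod n) := by
  have hB : (μ • matA) ^ n = complexMat ε := by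
    rw [smul_matA_pow_even μ (even_iff_two_dvd.2 hn), hμ, complexMat_apply]
    ext i j
    fin_cases i <;> fin_cases j <;> simp
  -- Each full turn `(μA)ⁿ = ε` of the exponent is absorbed into the coefficient.
  refine mem_matComponent.2 ⟨z * ε ^ (m / n), ?_⟩
  rw [ZMod.val_natCast, map_mul, map_pow, ← hB, ← pow_mul, mul_assoc, ← pow_add, Nat.div_add_mod]

lemma mul_mem_matComponent [NeZero n] (hn : 2 ∣ n) {ε : ℝ} (hμ : μ ^ n = ε) {i j : ZMod n}
    {M M' : Matrix (Fin 2) (Fin 2) ℂ} (h : M ∈ matComponent n μ i)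
    (h' : M' ∈ matComponent n μ j) : M * M' ∈ matComponent n μ (i + j) := by
  obtain ⟨z, rfl⟩ := mem_matComponent.1 h
  obtain ⟨w, rfl⟩ := mem_matComponent.1 h'
  obtain ⟨w', hw⟩ := exists_smul_matA_pow_mul_complexMat μ i.val w
  have := complexMat_mul_pow_mem hn hμ (z * w') (i.val + j.val)
  rw [Nat.cast_add, ZMod.natCast_zmod_val, ZMod.natCast_zmod_val] at this
  convert this using 1
  rw [map_mul, pow_add, mul_assoc, ← mul_assoc _ (complexMat w), hw]
  simp only [mul_assoc]

lemma pureTensor_mul (i j : ZMod n) (M M' : Matrix (Fin 2) (Fin 2) ℂ) :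
    pureTensor n i M * pureTensor n j M' = pureTensor n (i + j) (M * M') := by
  simp [pureTensor, AddMonoidAlgebra.single_mul_single]

lemma pureTensor_one : pureTensor n 0 1 = 1 := rfl

lemma pureTensor_pow (i : ZMod n) (M : Matrix (Fin 2) (Fin 2) ℂ) (m : ℕ) :
    pureTensor n i M ^ m = pureTensor n (m * i) (M ^ m) := by
  induction m with
  | zero => simp [pureTensor_one]
  | succ m ih => rw [pow_succ, ih, pureTensor_mul, pow_succ, Nat.cast_succ, add_one_mul]

/-- The linear map that reads off the matrix coefficient of `gʲ`. -/
def matCoeff (n : ℕ) (j : ZMod n) : Ambient n →ₗ[ℝ] Matrix (Fin 2) (Fin 2) ℂ :=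
  TensorProduct.lift
    { toFun := fun p => p.coeff j • LinearMap.id
      map_add' := fun p q => by simp [add_smul]
      map_smul' := fun r p => by simp [mul_smul] }

lemma matCoeff_pureTensor (i j : ZMod n) (M : Matrix (Fin 2) (Fin 2) ℂ) :
    matCoeff n i (pureTensor n j M) = if j = i then M else 0 := by
  simp only [matCoeff, pureTensor, TensorProduct.mk_apply, TensorProduct.lift.tmul]
  by_cases h : j = i <;> simp [h]

/-- The algebra is spanned by the products of its generators, and each product is a pure tensor of
the required form. -/
lemma matCoeff_mem [NeZero n] (hn : 2 ∣ n) {ε : ℝ} (hμ : μ ^ n = ε) {r : Ambient n}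
    (hr : r ∈ algE n μ) (i : ZMod n) : matCoeff n i r ∈ matComponent n μ i := by
  have key : ∀ r ∈ Submonoid.closure
      ({pureTensor n 0 matC, pureTensor n 1 (μ • matA)} : Set (Ambient n)),
      ∃ j, ∃ M ∈ matComponent n μ j, r = pureTensor n j M := by
    intro r hr
    induction hr using Submonoid.closure_induction with
    | mem r hr =>
      rcases hr with rfl | rfl
      · have := complexMat_mul_pow_mem hn hμ Complex.I 0
        rw [complexMat_I, pow_zero, mul_one, Nat.cast_zero] at this
        exact ⟨0, _, this, rfl⟩
      · have := complexMat_mul_pow_mem hn hμ 1 1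
        rw [map_one, pow_one, one_mul, Nat.cast_one] at this
        exact ⟨1, _, this, rfl⟩
    | one =>
      have := complexMat_mul_pow_mem hn hμ 1 0
      rw [map_one, pow_zero, one_mul, Nat.cast_zero] at this
      exact ⟨0, 1, this, rfl⟩
    | mul r s _ _ hr hs =>
      obtain ⟨i, M, hM, rfl⟩ := hr
      obtain ⟨j, M', hM', rfl⟩ := hs
      exact ⟨i + j, _, mul_mem_matComponent hn hμ hM hM', pureTensor_mul _ _ _ _⟩
  have hle : Subalgebra.toSubmodule (algE n μ) ≤ (matComponent n μ i).comap (matCoeff n i) := by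
    rw [algE, Algebra.adjoin_eq_span]
    refine Submodule.span_le.2 fun r hr => ?_
    obtain ⟨j, M, hM, rfl⟩ := key r hr
    simp only [SetLike.mem_coe, Submodule.mem_comap, matCoeff_pureTensor]
    split_ifs with h
    · exact h ▸ hM
    · exact zero_mem _
  exact hle hr

lemma exists_of_mem_algEComponent [NeZero n] (hn : 2 ∣ n) {ε : ℝ} (hμ : μ ^ n = ε) {j : ZMod n}
    {r : algE n μ} (hr : r ∈ algEComponent n μ j) :
    ∃ z, (r : Ambient n) = pureTensor n j (complexMat z * (μ • matA) ^ j.val) := by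
  obtain ⟨M, hM⟩ := hr
  have h := matCoeff_mem hn hμ r.2 j
  change pureTensor n j M = (r : Ambient n) at hM
  rw [← hM, matCoeff_pureTensor, if_pos rfl] at h
  obtain ⟨z, rfl⟩ := mem_matComponent.1 h
  exact ⟨z, hM.symm⟩

lemma pureTensor_mem_algE [NeZero n] (j : ZMod n) (z : ℂ) :
    pureTensor n j (complexMat z * (μ • matA) ^ j.val) ∈ algE n μ := by
  have hC : pureTensor n 0 matC ∈ algE n μ := Algebra.subset_adjoin (Or.inl rfl)
  have hA : pureTensor n 1 (μ • matA) ∈ algE n μ := Algebra.subset_adjoin (Or.inr rfl)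
  have hz : pureTensor n 0 (complexMat z) ∈ algE n μ := by
    have : complexMat z = z.re • 1 + z.im • matC := by
      rw [complexMat_apply]
      ext i j
      fin_cases i <;> fin_cases j <;> simp [matC]
    rw [this, map_add, map_smul, map_smul, pureTensor_one]
    exact add_mem (Subalgebra.smul_mem _ (one_mem _) _) (Subalgebra.smul_mem _ hC _)
  have := mul_mem hz (pow_mem hA j.val)
  rwa [pureTensor_pow, pureTensor_mul, mul_one, zero_add, ZMod.natCast_zmod_val] at this

lemma mem_algEComponent_of_eq {j : ZMod n} {r : algE n μ} {M : Matrix (Fin 2) (Fin 2) ℂ}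
    (h : (r : Ambient n) = pureTensor n j M) : r ∈ algEComponent n μ j :=
  ⟨M, h.symm⟩

instance : SetLike.GradedMonoid (algEComponent n μ) where
  one_mem := mem_algEComponent_of_eq pureTensor_one.symm
  mul_mem i j r s hr hs := by
    obtain ⟨M, hM⟩ := hr
    obtain ⟨M', hM'⟩ := hs
    refine mem_algEComponent_of_eq (M := M * M') ?_
    rw [← pureTensor_mul, hM, hM']
    rfl

lemma evenCommutators_subset [NeZero n] (hn : 2 ∣ n) {ε : ℝ} (hμ : μ ^ n = ε) :
    evenCommutators n ⊆ gradedIdentities (K := ℝ) (A := algE n μ) (algEComponent n μ) := by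
  rintro _ ⟨k₁, k₂, h₁, h₂, rfl⟩ a ha
  rw [even_iff_even_val hn] at h₁ h₂
  obtain ⟨z₁, e₁⟩ := exists_of_mem_algEComponent hn hμ (ha (1, k₁))
  obtain ⟨z₂, e₂⟩ := exists_of_mem_algEComponent hn hμ (ha (2, k₂))
  apply Subtype.ext
  simp only [x, map_sub, map_mul, FreeAlgebra.lift_ι_apply, AddSubgroupClass.coe_sub,
    MulMemClass.coe_mul, ZeroMemClass.coe_zero, e₁, e₂, pureTensor_mul]
  rw [sub_eq_zero, add_comm k₂, smul_matA_pow_even μ h₁, smul_matA_pow_even μ h₂]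
  simp only [Algebra.mul_smul_comm, mul_one, Algebra.smul_mul_assoc, ← map_mul]
  rw [smul_comm, mul_comm z₁]

/-- The product of three odd matrices. -/
lemma complexMat_mul_pow_mul_three {a b c : ℕ} (ha : Odd a) (hb : Odd b) (z₁ z₂ z₃ : ℂ) :
    complexMat z₁ * (μ • matA) ^ a * (complexMat z₂ * (μ • matA) ^ b) *
      (complexMat z₃ * (μ • matA) ^ c) =
    complexMat (z₁ * star z₂ * z₃) * (μ • matA) ^ (a + b + c) := by
  calc _ = complexMat z₁ * ((μ • matA) ^ a * complexMat z₂) * ((μ • matA) ^ b * complexMat z₃) *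
      (μ • matA) ^ c := by simp only [mul_assoc]
    _ = complexMat z₁ * complexMat (star z₂) * (((μ • matA) ^ a * complexMat (star z₃)) *
      (μ • matA) ^ b) * (μ • matA) ^ c := by
        rw [smul_matA_pow_mul_complexMat_of_odd μ ha, smul_matA_pow_mul_complexMat_of_odd μ hb]
        simp only [mul_assoc]
    _ = _ := by
        rw [smul_matA_pow_mul_complexMat_of_odd μ ha, star_star]
        simp only [map_mul, pow_add, mul_assoc]

lemma oddTriples_subset [NeZero n] (hn : 2 ∣ n) {ε : ℝ} (hμ : μ ^ n = ε) :
    oddTriples n ⊆ gradedIdentities (K := ℝ) (A := algE n μ) (algEComponent n μ) := by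
  rintro _ ⟨k₁, k₂, k₃, h₁, h₂, h₃, rfl⟩ a ha
  rw [odd_iff_odd_val hn] at h₁ h₂ h₃
  obtain ⟨z₁, e₁⟩ := exists_of_mem_algEComponent hn hμ (ha (1, k₁))
  obtain ⟨z₂, e₂⟩ := exists_of_mem_algEComponent hn hμ (ha (2, k₂))
  obtain ⟨z₃, e₃⟩ := exists_of_mem_algEComponent hn hμ (ha (3, k₃))
  apply Subtype.ext
  simp only [x, map_sub, map_mul, FreeAlgebra.lift_ι_apply, AddSubgroupClass.coe_sub,
    MulMemClass.coe_mul, ZeroMemClass.coe_zero, e₁, e₂, e₃, pureTensor_mul]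
  -- The coefficient `z₁ z̄₂ z₃` is symmetric in the outer factors.
  rw [sub_eq_zero, complexMat_mul_pow_mul_three h₁ h₂, complexMat_mul_pow_mul_three h₃ h₂,
    show k₃ + k₂ + k₁ = k₁ + k₂ + k₃ by ring,
    show k₃.val + k₂.val + k₁.val = k₁.val + k₂.val + k₃.val by ring,
    show z₃ * star z₂ * z₁ = z₁ * star z₂ * z₃ by ring]

lemma mem_center_of_commute {c : algE n μ}
    (hC : Commute (c : Ambient n) (pureTensor n 0 matC))
    (hA : Commute (c : Ambient n) (pureTensor n 1 (μ • matA))) :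
    c ∈ Subalgebra.center ℝ (algE n μ) := by
  have hle : algE n μ ≤ Subalgebra.centralizer ℝ {(c : Ambient n)} := by
    refine Algebra.adjoin_le ?_
    rintro _ (rfl | rfl)
    · exact (Subalgebra.mem_centralizer_iff ℝ).2 (by rintro _ rfl; exact hC.eq)
    · exact (Subalgebra.mem_centralizer_iff ℝ).2 (by rintro _ rfl; exact hA.eq)
  rw [Subalgebra.mem_center_iff]
  intro r
  exact Subtype.ext (Subalgebra.mem_centralizer_iff ℝ |>.1 (hle r.2) _ rfl).symm

lemma oddAnticommutators_subset [NeZero n] (hn : 2 ∣ n) {ε : ℝ} (hμ : μ ^ n = ε) :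
    oddAnticommutators n ⊆ gradedCentralPolynomials (K := ℝ) (A := algE n μ) (algEComponent n μ) := by
  rintro _ ⟨k₁, k₂, h₁, h₂, rfl⟩ a ha
  rw [odd_iff_odd_val hn] at h₁ h₂
  obtain ⟨z₁, e₁⟩ := exists_of_mem_algEComponent hn hμ (ha (1, k₁))
  obtain ⟨z₂, e₂⟩ := exists_of_mem_algEComponent hn hμ (ha (2, k₂))
  have h2 : ∀ (p q : ℕ) (z w : ℂ), Odd p → complexMat z * (μ • matA) ^ p *
      (complexMat w * (μ • matA) ^ q) = complexMat (z * star w) * (μ • matA) ^ (p + q) := by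
    intro p q z w hp
    rw [mul_assoc, ← mul_assoc _ (complexMat w), smul_matA_pow_mul_complexMat_of_odd μ hp]
    simp only [map_mul, pow_add, mul_assoc]
  -- The two coefficients are conjugate, so their sum is real; the power of `μA` is even, so the
  -- whole value is a scalar matrix.
  obtain ⟨t, ht⟩ : ∃ t : ℝ, z₁ * star z₂ + z₂ * star z₁ = t :=
    ⟨2 * (z₁ * star z₂).re, by
      apply Complex.ext
      · simp; ring
      · simp; ring⟩
  have e : ((FreeAlgebra.lift ℝ a (x ℝ 1 k₁ * x ℝ 2 k₂ + x ℝ 2 k₂ * x ℝ 1 k₁) :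
      algE n μ) : Ambient n) = pureTensor n (k₁ + k₂) (t • (μ ^ (k₁.val + k₂.val) • 1)) := by
    simp only [x, map_add, map_mul, FreeAlgebra.lift_ι_apply, AddMemClass.coe_add,
      MulMemClass.coe_mul, e₁, e₂, pureTensor_mul]
    rw [h2 _ _ _ _ h₁, h2 _ _ _ _ h₂, add_comm k₂, add_comm k₂.val, ← map_add, ← add_mul,
      ← map_add, ht, smul_matA_pow_even μ (h₁.add_odd h₂), complexMat_apply]
    congr 1
    ext i j
    fin_cases i <;> fin_cases j <;> simp [mul_comm]
  apply mem_center_of_commute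
  · rw [e, Commute, SemiconjBy, pureTensor_mul, pureTensor_mul, add_comm]
    simp
  · rw [e, Commute, SemiconjBy, pureTensor_mul, pureTensor_mul, add_comm]
    congr 1
    simp only [Algebra.mul_smul_comm, mul_one, Algebra.smul_mul_assoc, one_mul]
    rw [smul_comm μ t, smul_comm μ]

end Structure

/-! ### Diagonalising `C`: from the algebra to generic matrices -/

section Evaluation

variable {n : ℕ} {μ : ℂ}

/-- The algebra map that sends `gʲ ⊗ M` to `M`. -/
def augment (n : ℕ) : Ambient n →ₐ[ℝ] Matrix (Fin 2) (Fin 2) ℂ :=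
  (Algebra.TensorProduct.lid ℝ (Matrix (Fin 2) (Fin 2) ℂ)).toAlgHom.comp
    (Algebra.TensorProduct.map (AddMonoidAlgebra.lift ℝ ℝ (ZMod n) 1) (AlgHom.id ℝ _))

lemma augment_pureTensor (j : ZMod n) (M : Matrix (Fin 2) (Fin 2) ℂ) :
    augment n (pureTensor n j M) = M := by
  simp [augment, pureTensor]

/-- The matrix of eigenvectors of `C`. -/
def eigenMat : Matrix (Fin 2) (ZMod 2) ℂ :=
  Matrix.of fun i j => if i = 0 then 1 else if j = 0 then Complex.I else -Complex.I

lemma eq_zero_of_eigenMat_mul {X : Matrix (ZMod 2) (ZMod 2) ℂ} (h : eigenMat * X = 0) : X = 0 := by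
  have hI := Complex.I_ne_zero
  have h10 : (1 : ZMod 2) ≠ 0 := by decide
  have hs : ∀ s : ZMod 2, s = 0 ∨ s = 1 := by decide
  have key : ∀ j, X 0 j = 0 ∧ X 1 j = 0 := by
    intro j
    have h0 := congrFun (congrFun h 0) j
    have h1 := congrFun (congrFun h 1) j
    simp [Matrix.mul_apply, sum_zmod_two, eigenMat] at h0 h1
    have h2 : X 0 j = X 1 j := by
      apply mul_left_cancel₀ hI
      linear_combination h1
    rw [← h2] at h0 ⊢
    have : X 0 j = 0 := by linear_combination h0 / 2
    exact ⟨this, this⟩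
  ext i j
  rcases hs i with rfl | rfl
  · exact (key j).1
  · exact (key j).2

lemma complexMat_mul_eigenMat {α : Type*} (z : α → ℂ) (p : α) :
    complexMat (z p) * eigenMat = eigenMat * Matrix.diagonal fun j => conjPoint z (p, j) := by
  have hs : ∀ s : ZMod 2, s = 0 ∨ s = 1 := by decide
  have hI := Complex.I_mul_I
  have h1 : (z p : ℂ) = (z p).re + (z p).im * Complex.I := (Complex.re_add_im _).symm
  have h2 : starRingEnd ℂ (z p) = (z p).re - (z p).im * Complex.I := by
    apply Complex.ext <;> simp
  ext i j
  rw [Matrix.mul_diagonal, complexMat_apply]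
  rcases hs j with rfl | rfl <;> fin_cases i <;>
    simp only [Matrix.mul_apply, eigenMat, conjPoint, Fin.sum_univ_two, Matrix.of_apply] <;> simp
  · linear_combination -Complex.I * h1 - (z p).im * hI
  · linear_combination -h2
  · linear_combination Complex.I * h2 - (z p).im * hI

/-- The matrix that exchanges the two coordinates. -/
def swapMat : Matrix (ZMod 2) (ZMod 2) ℂ := Matrix.of fun i j => if j = i + 1 then 1 else 0

lemma matA_mul_eigenMat : matA * eigenMat = eigenMat * swapMat := by
  have hs : ∀ s : ZMod 2, s = 0 ∨ s = 1 := by decide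
  have h11 : (1 : ZMod 2) + 1 = 0 := rfl
  ext i j
  rcases hs j with rfl | rfl <;> fin_cases i <;>
    simp only [Matrix.mul_apply, sum_zmod_two, Fin.sum_univ_two] <;>
    simp [eigenMat, swapMat, matA, h11]

/-- Both evaluations are multiplicative and linear, so it is enough that the eigenvector matrix
intertwines them on scalars and letters. -/
lemma augment_lift_mul_eigenMat [NeZero n] (hn : 2 ∣ n) {z : ℕ × ZMod n → ℂ}
    {a : ℕ × ZMod n → algE n μ}
    (ha : ∀ p, (a p : Ambient n) = pureTensor n p.2 (complexMat (z p) * (μ • matA) ^ p.2.val))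
    (f : FreeGradedAlgebra ℝ (ZMod n)) :
    augment n (FreeAlgebra.lift ℝ a f) * eigenMat = eigenMat *
      (MvPolynomial.eval (conjPoint z)).mapMatrix
        (genericEval (letterParity hn) (fun p => p.2.val) μ f) := by
  have h11 : (1 : ZMod 2) + 1 = 0 := rfl
  induction f using FreeAlgebra.induction with
  | grade0 r =>
    rw [AlgHom.commutes, AlgHom.commutes, Subalgebra.coe_algebraMap, AlgHom.commutes]
    have h : (MvPolynomial.eval (conjPoint z)).mapMatrix (algebraMap ℝ _ r) =
        algebraMap ℝ (Matrix (ZMod 2) (ZMod 2) ℂ) r := by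
      ext i j
      by_cases hij : i = j <;>
        simp [Matrix.algebraMap_matrix_apply, hij, MvPolynomial.algebraMap_eq,
          IsScalarTower.algebraMap_apply ℝ ℂ (MvPolynomial _ ℂ)]
    rw [h, Algebra.algebraMap_eq_smul_one, Algebra.algebraMap_eq_smul_one, Matrix.smul_mul,
      Matrix.mul_smul, Matrix.one_mul, Matrix.mul_one]
  | grade1 p =>
    rw [FreeAlgebra.lift_ι_apply, ha, augment_pureTensor, genericEval, FreeAlgebra.lift_ι_apply]
    have hp : letterParity hn p = (p.2.val : ZMod 2) := castHom_eq_natCast_val hn p.2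
    rcases Nat.even_or_odd p.2.val with h | h
    · rw [ZMod.natCast_eq_zero_iff_even.2 h] at hp
      rw [smul_matA_pow_even μ h, Matrix.mul_smul, Matrix.mul_one, Matrix.smul_mul,
        complexMat_mul_eigenMat, ← Matrix.mul_smul]
      congr 1
      ext i j
      by_cases hij : i = j <;> simp [genericMatrix, hp, hij, eq_comm]
    · rw [ZMod.natCast_eq_one_iff_odd.2 h] at hp
      have hA : (μ • matA) ^ p.2.val = μ ^ p.2.val • matA := by
        obtain ⟨m, hm⟩ := h
        rw [hm, smul_pow, pow_succ matA, pow_mul matA, matA_sq, one_pow, one_mul]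
      rw [hA, Matrix.mul_smul, Matrix.smul_mul, Matrix.mul_assoc, matA_mul_eigenMat,
        ← Matrix.mul_assoc, complexMat_mul_eigenMat, Matrix.mul_assoc, ← Matrix.mul_smul]
      congr 1
      ext i j
      by_cases hij : j = i + 1 <;>
        simp [genericMatrix, hp, hij, swapMat, Matrix.diagonal_mul]
  | mul f g hf hg =>
    rw [map_mul, map_mul, map_mul, MulMemClass.coe_mul, map_mul, Matrix.mul_assoc, hg,
      ← Matrix.mul_assoc, hf, Matrix.mul_assoc]
  | add f g hf hg =>
    rw [map_add, map_add, map_add, AddMemClass.coe_add, map_add, Matrix.add_mul, hf, hg,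
      Matrix.mul_add]

/-- Every choice of complex numbers for the letters comes from an admissible substitution, so the
entries vanish at all conjugate points. -/
lemma genericEval_eq_zero [NeZero n] (hn : 2 ∣ n) {f : FreeGradedAlgebra ℝ (ZMod n)}
    (hf : f ∈ gradedIdentities (K := ℝ) (A := algE n μ) (algEComponent n μ)) :
    genericEval (letterParity hn) (fun p => p.2.val) μ f = 0 := by
  ext1 i j
  refine eq_zero_of_eval_conjPoint _ fun z => ?_
  have h := augment_lift_mul_eigenMat hn (μ := μ) (z := z)
    (a := fun p => ⟨_, pureTensor_mem_algE p.2 (z p)⟩) (fun p => rfl) f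
  rw [hf _ fun p => mem_algEComponent_of_eq rfl, ZeroMemClass.coe_zero, map_zero,
    Matrix.zero_mul] at h
  exact congrFun (congrFun (eq_zero_of_eigenMat_mul h.symm) i) j

end Evaluation

/-! ### The two bases -/

section Bases

variable {n : ℕ} [NeZero n] {μ : ℂ} {ε : ℝ}

theorem isTIdealBasis_gradedIdentities (hn : 2 ∣ n) (hμ : μ ^ n = ε) (hμ0 : μ ≠ 0) :
    IsTIdealBasis (evenCommutators n ∪ oddTriples n) (gradedIdentities (K := ℝ) (A := algE n μ) (algEComponent n μ)) :=
  isTIdealBasis_of (isTIdeal_gradedIdentities _)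
    (Set.union_subset (evenCommutators_subset hn hμ) (oddTriples_subset hn hμ))
    fun _ hJ hS _ hf => (isSwapClosed_of_isTIdeal hn hJ hS).mem_of_dataMap_eq_zero
      (dataMap_eq_zero_of_genericEval hμ0 (genericEval_eq_zero hn hf))

theorem isTSpaceBasis_gradedCentralPolynomials (hn : 2 ∣ n) (hμ : μ ^ n = ε) (hμ0 : μ ≠ 0) :
    IsTSpaceBasis ({1} ∪ oddAnticommutators n ∪ borderedEvenCommutators n ∪ borderedOddTriples n)
      (gradedCentralPolynomials (K := ℝ) (A := algE n μ) (algEComponent n μ)) := by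
  refine isTSpaceBasis_of (isTSpace_gradedCentral _) ?_ fun W hW hS f hf => ?_
  · have hI := isTIdeal_gradedIdentities (K := ℝ) (A := algE n μ) (algEComponent n μ)
    have hle : gradedIdentities (K := ℝ) (A := algE n μ) (algEComponent n μ) ⊆
        gradedCentralPolynomials (K := ℝ) (A := algE n μ) (algEComponent n μ) := fun f hf a ha => by
      rw [hf a ha]
      exact zero_mem _
    refine Set.union_subset (Set.union_subset (Set.union_subset ?_
      (oddAnticommutators_subset hn hμ)) ?_) ?_
    · rintro _ rfl a _
      rw [map_one]
      exact one_mem _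
    · rintro _ ⟨g₁, k₁, k₂, g₂, h₁, h₂, rfl⟩
      -- The bordered polynomials are multiples of renumbered identities, hence identities, hence
      -- central.
      obtain ⟨φ, hφ, h⟩ := hI.1.exists_wordSubst fun i => [[], [(2, k₁)], [(3, k₂)]].getD i []
      have := hφ _ (evenCommutators_subset hn hμ ⟨k₁, k₂, h₁, h₂, rfl⟩)
      have e1 := h 1
      have e2 := h 2
      simp only [List.getD_cons_zero, List.getD_cons_succ, wordDegree, List.map_cons,
        List.map_nil, List.sum_singleton, word_cons, word_nil, mul_one] at e1 e2
      rw [map_sub, map_mul, map_mul, e1, e2] at this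
      exact hle (hI.2 _ (hI.2 _ this _).1 _).2
    · rintro _ ⟨g₁, k₁, k₂, k₃, g₂, h₁, h₂, h₃, rfl⟩
      obtain ⟨φ, hφ, h⟩ := hI.1.exists_wordSubst
        fun i => [[], [(2, k₁)], [(3, k₂)], [(4, k₃)]].getD i []
      have := hφ _ (oddTriples_subset hn hμ ⟨k₁, k₂, k₃, h₁, h₂, h₃, rfl⟩)
      have e1 := h 1
      have e2 := h 2
      have e3 := h 3
      simp only [List.getD_cons_zero, List.getD_cons_succ, wordDegree, List.map_cons,
        List.map_nil, List.sum_singleton, word_cons, word_nil, mul_one] at e1 e2 e3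
      rw [map_sub, map_mul, map_mul, map_mul, map_mul, e1, e2, e3] at this
      exact hle (hI.2 _ (hI.2 _ this _).1 _).2
  -- One odd and one even letter to commute with `f`.
  · have hodd : letterParity hn (0, 1) = 1 := map_one _
    have heven : letterParity hn (0, 0) = 0 := map_zero _
    refine (isSwapClosed_of_isTSpace hn hW (fun _ h => hS (Or.inl (Or.inr h)))
      (fun _ h => hS (Or.inr h))).mem_of_dataMap_symm (hS (Or.inl (Or.inl (Or.inl rfl))))
      (word_append_add_mem_of_isTSpace hn hW fun _ h => hS (Or.inl (Or.inl (Or.inr h)))) ?_ ?_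
    · exact fun d hd => dataMap_eq_zero_of_odd hμ0 heven
        (genericEval_eq_zero hn (mul_ι_sub_mem_gradedIdentities hf (0, 0))) hd
    · exact fun d hd => dataMap_eq_of_even hμ0 hodd
        (genericEval_eq_zero hn (mul_ι_sub_mem_gradedIdentities hf (0, 1))) hd

end Bases

end GradedPI

end

theorem mainTheorem6 (k : ℕ) (hk : 1 ≤ k) (ε : ℝ) (hε : ε = 1 ∨ ε = -1)
    (μ : ℂ) (hμ : μ ^ (2 ^ k) = (ε : ℂ)) :
    GradedPI.IsTIdealBasis
      (GradedPI.evenCommutators (2 ^ k) ∪ GradedPI.oddTriples (2 ^ k))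
      (GradedPI.gradedIdentities (K := ℝ) (A := GradedPI.algE (2 ^ k) μ)
        (GradedPI.algEComponent (2 ^ k) μ)) ∧
    GradedPI.IsTSpaceBasis
      ({1} ∪ GradedPI.oddAnticommutators (2 ^ k) ∪
        GradedPI.borderedEvenCommutators (2 ^ k) ∪ GradedPI.borderedOddTriples (2 ^ k))
      (GradedPI.gradedCentralPolynomials (K := ℝ) (A := GradedPI.algE (2 ^ k) μ)
        (GradedPI.algEComponent (2 ^ k) μ)) := by
  have hn : 2 ∣ 2 ^ k := dvd_pow_self 2 (by omega)
  have hμ0 : μ ≠ 0 := by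
    rintro rfl
    rw [zero_pow (by positivity)] at hμ
    rcases hε with rfl | rfl <;> simp at hμ
  exact ⟨GradedPI.isTIdealBasis_gradedIdentities hn hμ hμ0,
    GradedPI.isTSpaceBasis_gradedCentralPolynomials hn hμ hμ0⟩
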